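/- A \emph{set system} is a family $\mathcal A$ of sets. A \emph{weak conflict free coloring} of $\mathcal A$ with $\rho$ colors ($\rho$ a cardinal) is a partial function $f$ from $\bigcup\mathcal A$ to $\rho$ (i.e. $\operatorname{dom}(f)\subseteq\bigcup\mathcal A$) such that for every $A\in\mathcal A$ there is a color $\zeta<\rho$ with $|A\cap f^{-1}\{\zeta\}|=1$. Let $w\chi_{\rm CF}(\mathcal A)$ be the smallest $\rho$ for which $\mathcal A$ has a weak conflict free coloring with $\rho$ colors. For cardinals $\lambda\ge\kappa\ge\mu$ with $\lambda$ infinite, a \emph{$(\lambda,\kappa,\mu)$-system} is a set system $\mathcal A$ with $|\mathcal A|=\lambda$, $|A|=\kappa$ for all $A\in\mathcal A$, and $|A\cap A'|<\mu$ for all distinct $A,A'\in\mathcal A$; put $$w\chi_{\rm CF}(\lambda,\kappa,\mu)=\sup\{w\chi_{\rm CF}(\mathcal A):\mathcal A\text{ is a }(\lambda,\kappa,\mu)\text{-system}\}.$$ Let $\beth_0(\kappa)=\kappa$ and $\beth_{r+1}(\kappa)=2^{\beth_r(\kappa)}$, and let $\kappa^{+m}$ denote the $m$-th cardinal successor of $\kappa$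 (so $\kappa^{+0}=\kappa$). \textbf{Corollary.} Let $\kappa$ be an infinite cardinal and let $m\ge 0$ be an integer. If $\beth_m(\kappa)=\kappa^{+m}$, then $$w\chi_{\rm CF}(\kappa^{+m},\kappa,2)=\left\lfloor\frac m2\right\rfloor+2 .$$ -/

import Mathlib

universe u

namespace ConflictFree

open Cardinal

/-- `f` is a weak conflict free coloring of the set system `A` with colors from `C`: a partial
function (`none` means uncolored) with domain contained in `⋃ A` such that every `S ∈ A` meets
some color class in exactly one point. -/
def IsWeakColoring {α C : Type u} (A : Set (Set α)) (f : α → Option C) : Prop :=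
  {x | f x ≠ none} ⊆ ⋃₀ A ∧
    ∀ S ∈ A, ∃ c : C, (S ∩ {x | f x = some c}).encard = 1

/-- The weak conflict free chromatic number of a set system: the smallest number of colors
in a weak conflict free coloring. -/
noncomputable def weakChromaticNumber {α : Type u} (A : Set (Set α)) : Cardinal.{u} :=
  sInf {ρ | ∃ C : Type u, #C = ρ ∧ ∃ f : α → Option C, IsWeakColoring A f}

/-- `A` is an `(l, κ, μ)`-system: it has `l` members, each of size `κ`, and is
`μ`-almost disjoint. -/
structure IsSystem {α : Type u} (l κ μ : Cardinal.{u}) (A : Set (Set α)) : Prop where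
  card_eq : #A = l
  card_mem : ∀ S ∈ A, #S = κ
  card_inter_lt : ∀ S ∈ A, ∀ T ∈ A, S ≠ T → #(S ∩ T : Set α) < μ

/-- The supremum of the weak conflict free chromatic numbers of all `(l, κ, μ)`-systems. -/
noncomputable def weakChromaticSup (l κ μ : Cardinal.{u}) : Cardinal.{u} :=
  sSup {ρ | ∃ (α : Type u) (A : Set (Set α)), IsSystem l κ μ A ∧ weakChromaticNumber A = ρ}

/-- The finite iterates of the power `x ↦ 2 ^ x` starting from `κ`. -/
noncomputable def bethFrom (κ : Cardinal.{u}) : ℕ → Cardinal.{u}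
  | 0 => κ
  | r + 1 => 2 ^ bethFrom κ r

/-- The `m`-th cardinal successor of `κ`. -/
noncomputable def succIter (κ : Cardinal.{u}) : ℕ → Cardinal.{u}
  | 0 => κ
  | m + 1 => Order.succ (succIter κ m)

end ConflictFree

namespace ConflictFree

open Cardinal

/-! Upper bound. `exists_points` picks one representative in each set so that the relation "the
representative of `j` lies in `S i`" is well-founded and each set contains at most `m + 2`
representatives of other sets. Only representatives are colored, by recursion along this relation.
With `N = m / 2 + 2` colors, `m + 2 < 2 * N`, so some color occurs at most once on the other
representatives in a set. If a color occurs exactly once, the set's own representative stays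
uncolored; otherwise it receives a color that does not occur yet (`exists_color_encard_eq_one`).
This direction holds in ZFC.

Lower bound. Put `l = m / 2`. In the affine plane over a field of size `κ`, no point set meets every
line exactly once. So `l + 1` colors fail on the plane if each line may carry `2 * l` fictitious
colors: all admitted colors but one, each twice (`forces_planeLine`). `CopyIndex.forces_edge`
replaces one fictitious color per edge by a real point of an earlier copy of the system, at the cost
of one exponentiation. After `2 * l ≤ m` rounds no fictitious color remains, and the system has at
most `bethFrom κ m = succIter κ m` edges. Disjoint sets pad it to the exact size. -/

theorem exists_linearOrder_mk_Iio_lt (ι : Type u) :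
    ∃ _ : LinearOrder ι, WellFoundedLT ι ∧ ∀ i : ι, #(Set.Iio i) < #ι := by
  obtain ⟨_, _, h⟩ := Cardinal.exists_ord_eq_type_lt ι
  exact ⟨inferInstance, inferInstance, fun i => mk_Iio_lt i h⟩

theorem mk_iUnion_le_mul {ι α : Type u} (f : ι → Set α) {c : Cardinal.{u}}
    (h : ∀ i, #(f i) ≤ c) : #(⋃ i, f i : Set α) ≤ #ι * c :=
  (mk_iUnion_le f).trans (mul_le_mul_right (ciSup_le' h) _)

theorem mk_iUnion_subsingleton_le {ι α : Type u} (f : ι → Set α)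
    (h : ∀ i, (f i).Subsingleton) : #(⋃ i, f i : Set α) ≤ #ι := by
  simpa using mk_iUnion_le_mul f (c := 1) fun i => mk_le_one_iff_set_subsingleton.2 (h i)

/-- Recursive choice along a well-founded relation of values subject to a constraint that depends
only on the values chosen before. -/
theorem exists_forall_of_wellFounded {ι β : Type*} [Nonempty β] {r : ι → ι → Prop}
    (hr : WellFounded r) (P : ι → (ι → β) → β → Prop)
    (hP : ∀ i c c' o, (∀ j, r j i → c j = c' j) → P i c o → P i c' o)
    (h : ∀ i c, ∃ o, P i c o) : ∃ c : ι → β, ∀ i, P i c (c i) := by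
  classical
  choose g hg using h
  let F : ∀ i, (∀ j, r j i → β) → β := fun i rec =>
    g i fun j => if hj : r j i then rec j hj else Classical.arbitrary β
  refine ⟨hr.fix F, fun i => ?_⟩
  rw [hr.fix_eq]
  refine hP i _ _ _ (fun j hj => ?_) (hg i _)
  simp [hj]

/-! ### Upper bound: representatives for at most `κ` sets -/

/-- `j` precedes `i` if the point chosen for `j` lies in the set `S i`. -/
def Prec {ι α : Type*} (S : ι → Set α) (x : ι → α) (j i : ι) : Prop :=
  j ≠ i ∧ x j ∈ S i

/-- Enumerate the sets so that each has fewer than `κ` predecessors. The representative of `S i`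
avoids all earlier sets, and also every other set that already contains two earlier representatives.
Hence no set can acquire a third representative before its own turn. -/
theorem exists_points_of_mk_le {ι α : Type u} (S : ι → Set α) {κ : Cardinal.{u}} (hκ : ℵ₀ ≤ κ)
    (hι : #ι ≤ κ) (hS : ∀ i, κ ≤ #(S i))
    (hd : ∀ i j, i ≠ j → (S i ∩ S j).Subsingleton) :
    ∃ x : ι → α, (∀ i, x i ∈ S i) ∧ WellFounded (Prec S x) ∧
      ∀ i, {j | Prec S x j i}.encard ≤ 2 := by
  rcases isEmpty_or_nonempty ι with hι0 | ⟨⟨i0⟩⟩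
  · exact ⟨isEmptyElim, isEmptyElim, ⟨isEmptyElim⟩, isEmptyElim⟩
  have : Nonempty α := by
    have : #(S i0) ≠ 0 := (aleph0_pos.trans_le (hκ.trans (hS i0))).ne'
    obtain ⟨p⟩ := mk_ne_zero_iff.1 this
    exact ⟨p⟩
  obtain ⟨_, _, hlt⟩ := exists_linearOrder_mk_Iio_lt ι
  obtain ⟨x, hx⟩ := exists_forall_of_wellFounded (r := ((· < ·) : ι → ι → Prop)) wellFounded_lt
    (fun i (g : ι → α) p => p ∈ S i ∧ (∀ j < i, p ∉ S j) ∧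
      ∀ j < i, ∀ j' < i, g j ≠ g j' → ∀ k, k ≠ i → g j ∈ S k → g j' ∈ S k → p ∉ S k)
    (by
      rintro i c c' o hc ⟨h1, h2, h3⟩
      refine ⟨h1, h2, fun j hj j' hj' => ?_⟩
      rw [← hc j hj, ← hc j' hj']
      exact h3 j hj j' hj')
    (by
      intro i g
      by_contra! hcon
      let B1 : Set α := ⋃ j : Set.Iio i, S i ∩ S j
      let B2 : Set α := ⋃ j : Set.Iio i × Set.Iio i, {p | p ∈ S i ∧ g j.1 ≠ g j.2 ∧ ∃ k, k ≠ i ∧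
        g j.1 ∈ S k ∧ g j.2 ∈ S k ∧ p ∈ S k}
      have hsub : S i ⊆ B1 ∪ B2 := by
        intro p hp
        by_cases hp1 : p ∈ B1
        · exact Or.inl hp1
        · obtain ⟨j, hj, j', hj', hne, k, hk, hjk, hjk', hpk⟩ := hcon p hp (fun j hj hpj =>
            hp1 (Set.mem_iUnion.2 ⟨⟨j, hj⟩, hp, hpj⟩))
          exact Or.inr (Set.mem_iUnion.2 ⟨(⟨j, hj⟩, ⟨j', hj'⟩), hp, hne, k, hk, hjk, hjk', hpk⟩)
      have hI : #(Set.Iio i) < κ := (hlt i).trans_le hι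
      have h1 : #B1 < κ :=
        (mk_iUnion_subsingleton_le (fun j : Set.Iio i => S i ∩ S j) fun j =>
          hd i j (ne_of_gt (Set.mem_Iio.1 j.2))).trans_lt hI
      -- Two distinct points lie in at most one `S k`, and this meets `S i` at most once, so each
      -- pair of earlier points forbids at most one point.
      have h2 : #B2 < κ := by
        refine (mk_iUnion_subsingleton_le _ ?_).trans_lt
          (by simpa using mul_lt_of_lt hκ hI hI)
        rintro ⟨j, j'⟩ p ⟨hp, hne, k, hk, hjk, hjk', hpk⟩ q ⟨hq, -, k', hk', hjl, hjl', hql⟩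
        have : k = k' := by
          by_contra hkk
          exact hne (hd k k' hkk ⟨hjk, hjl⟩ ⟨hjk', hjl'⟩)
        subst this
        exact hd k i hk ⟨hpk, hp⟩ ⟨hql, hq⟩
      exact absurd ((hS i).trans ((mk_le_mk_of_subset hsub).trans (mk_union_le _ _)))
        (add_lt_of_lt hκ h1 h2).not_ge)
  have hprec : ∀ j i, Prec S x j i → j < i := by
    rintro j i ⟨hne, hmem⟩
    by_contra hlt
    exact (hx j).2.1 i (lt_of_le_of_ne (not_lt.1 hlt) hne.symm) hmem
  have hinj : ∀ j i, j < i → x j ≠ x i := fun j i hji he =>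
    (hx i).2.1 j hji (he ▸ (hx j).1)
  refine ⟨x, fun i => (hx i).1, Subrelation.wf (@fun j i h => hprec j i h) wellFounded_lt,
    fun i => ?_⟩
  by_contra! hcard
  have key : ∀ a b c, Prec S x a i → Prec S x b i → Prec S x c i → a < c → b < c → a = b := by
    intro a b c ha hb hc hac hbc
    by_contra hab
    have hne : x a ≠ x b := by
      rcases lt_or_gt_of_ne hab with h | h
      · exact hinj _ _ h
      · exact (hinj _ _ h).symm
    exact (hx c).2.2 a hac b hbc hne i (hprec c i hc).ne' ha.2 hb.2 hc.2
  obtain ⟨T, hT, hT3⟩ := Set.exists_subset_encard_eq (k := 3) (by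
    simpa [one_add_one_eq_two, two_add_one_eq_three] using Order.add_one_le_of_lt hcard)
  obtain ⟨a, b, c, hab, hac, hbc, rfl⟩ := Set.encard_eq_three.1 hT3
  have ha : Prec S x a i := hT (by simp)
  have hb : Prec S x b i := hT (by simp)
  have hc : Prec S x c i := hT (by simp)
  rcases lt_or_gt_of_ne hab with h1 | h1 <;> rcases lt_or_gt_of_ne hac with h2 | h2 <;>
    rcases lt_or_gt_of_ne hbc with h3 | h3
  · exact hab (key a b c ha hb hc h2 h3)
  · exact hac (key a c b ha hc hb h1 h3)
  · exact absurd (h1.trans h3) h2.not_gt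
  · exact hac (key a c b ha hc hb h1 h3)
  · exact hab (key a b c ha hb hc h2 h3)
  · exact absurd (h2.trans h3) h1.not_gt
  · exact hbc (key b c a hb hc ha h1 h2)
  · exact hbc (key b c a hb hc ha h1 h2)

/-! ### Upper bound: closures and the induction on `m` -/

/-- `T` together with the indices of all sets containing two points of `⋃ j ∈ T, S j`. -/
def spanStep {ι α : Type*} (S : ι → Set α) (T : Set ι) : Set ι :=
  T ∪ {k | ∃ p q, p ≠ q ∧ p ∈ ⋃ j ∈ T, S j ∧ q ∈ ⋃ j ∈ T, S j ∧ p ∈ S k ∧ q ∈ S k}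

/-- The closure of `T` under `spanStep`. -/
def span {ι α : Type*} (S : ι → Set α) (T : Set ι) : Set ι :=
  ⋃ n : ℕ, (spanStep S)^[n] T

theorem spanStep_mono {ι α : Type*} (S : ι → Set α) : Monotone (spanStep S) := by
  intro T T' h
  have h' : ⋃ j ∈ T, S j ⊆ ⋃ j ∈ T', S j := Set.biUnion_subset_biUnion_left h
  rintro k (hk | ⟨p, q, hne, hp, hq, hpk, hqk⟩)
  · exact Or.inl (h hk)
  · exact Or.inr ⟨p, q, hne, h' hp, h' hq, hpk, hqk⟩

theorem span_mono {ι α : Type*} (S : ι → Set α) : Monotone (span S) := fun _ _ h =>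
  Set.iUnion_mono fun n => (spanStep_mono S).iterate n h

theorem subset_span {ι α : Type*} (S : ι → Set α) (T : Set ι) : T ⊆ span S T :=
  Set.subset_iUnion (fun n : ℕ => (spanStep S)^[n] T) 0

theorem mem_span_of_ne {ι α : Type*} (S : ι → Set α) (T : Set ι) {j j' k : ι} {p q : α}
    (hj : j ∈ span S T) (hj' : j' ∈ span S T) (hpj : p ∈ S j) (hqj : q ∈ S j') (hne : p ≠ q)
    (hp : p ∈ S k) (hq : q ∈ S k) : k ∈ span S T := by
  obtain ⟨n, hn⟩ := Set.mem_iUnion.1 hj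
  obtain ⟨n', hn'⟩ := Set.mem_iUnion.1 hj'
  have hmono : Monotone fun n : ℕ => (spanStep S)^[n] T := by
    refine monotone_nat_of_le_succ fun n => ?_
    rw [Function.iterate_succ_apply']
    exact Set.subset_union_left
  refine Set.mem_iUnion.2 ⟨max n n' + 1, ?_⟩
  rw [Function.iterate_succ_apply']
  exact Or.inr ⟨p, q, hne, Set.mem_biUnion (hmono (le_max_left n n') hn) hpj,
    Set.mem_biUnion (hmono (le_max_right n n') hn') hqj, hp, hq⟩

/-- By almost disjointness a pair of distinct points lies in at most one set, so at most `c * c = c`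
indices are added. -/
theorem mk_spanStep_le {ι α : Type u} (S : ι → Set α) {c : Cardinal.{u}} (hc : ℵ₀ ≤ c)
    (hS : ∀ i, #(S i) ≤ c) (hd : ∀ i j, i ≠ j → (S i ∩ S j).Subsingleton) {T : Set ι}
    (hT : #T ≤ c) : #(spanStep S T) ≤ c := by
  have hU : #(⋃ j ∈ T, S j : Set α) ≤ c := by
    rw [Set.biUnion_eq_iUnion]
    exact (mk_iUnion_le_mul _ fun i : T => hS i).trans
      ((mul_le_mul_left hT _).trans (mul_eq_self hc).le)
  have hsub : spanStep S T ⊆ T ∪ ⋃ z : (⋃ j ∈ T, S j : Set α) × (⋃ j ∈ T, S j : Set α),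
      {k | z.1 ≠ z.2 ∧ z.1.1 ∈ S k ∧ z.2.1 ∈ S k} := by
    rintro k (hk | ⟨p, q, hne, hp, hq, hpk, hqk⟩)
    · exact Or.inl hk
    · exact Or.inr (Set.mem_iUnion.2 ⟨(⟨p, hp⟩, ⟨q, hq⟩), by simpa using hne, hpk, hqk⟩)
  refine (mk_le_mk_of_subset hsub).trans ((mk_union_le _ _).trans (add_le_of_le hc hT ?_))
  refine (mk_iUnion_subsingleton_le _ ?_).trans ?_
  · rintro ⟨p, q⟩ k ⟨hne, hk⟩ k' ⟨-, hk'⟩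
    by_contra hkk
    exact hne (Subtype.ext (hd k k' hkk ⟨hk.1, hk'.1⟩ ⟨hk.2, hk'.2⟩))
  · rw [mk_prod, lift_id]
    exact (mul_le_mul' hU hU).trans (mul_eq_self hc).le

theorem mk_span_le {ι α : Type u} (S : ι → Set α) {c : Cardinal.{u}} (hc : ℵ₀ ≤ c)
    (hS : ∀ i, #(S i) ≤ c) (hd : ∀ i j, i ≠ j → (S i ∩ S j).Subsingleton) {T : Set ι}
    (hT : #T ≤ c) : #(span S T) ≤ c := by
  have h : ∀ n : ULift.{u} ℕ, #((spanStep S)^[n.down] T) ≤ c := by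
    rintro ⟨n⟩
    induction n with
    | zero => exact hT
    | succ n ih =>
      simp only [Function.iterate_succ_apply']
      exact mk_spanStep_le S hc hS hd ih
  have he : span S T = ⋃ n : ULift.{u} ℕ, (spanStep S)^[n.down] T := by
    ext k
    simp [span]
  rw [he]
  exact (mk_iUnion_le_mul _ h).trans ((mul_le_mul' (by simpa using hc) le_rfl).trans
    (mul_eq_self hc).le)

theorem succIter_le (κ : Cardinal.{u}) (m : ℕ) : κ ≤ succIter κ m := by
  induction m with
  | zero => exact le_rfl
  | succ m ih => exact ih.trans (Order.le_succ _)

theorem le_mk_sdiff_of_subsingleton {α : Type u} {κ : Cardinal.{u}} (hκ : ℵ₀ ≤ κ) {A B : Set α}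
    (hA : κ ≤ #A) (h : (A ∩ B).Subsingleton) : κ ≤ #(A \ B : Set α) := by
  by_contra! hlt
  have h1 := le_mk_sdiff_add_mk A (A ∩ B)
  rw [Set.sdiff_self_inter] at h1
  exact (hA.trans h1).not_gt (add_lt_of_lt hκ hlt
    ((mk_le_one_iff_set_subsingleton.2 h).trans_lt (one_lt_aleph0.trans_le hκ)))

/-- An almost disjoint family of at most `κ^{+m}` sets of size `κ` has a system of representatives
that can be arranged so that every set contains at most `m + 2` representatives of earlier sets,
and none of later ones. -/
theorem exists_points {α : Type u} {κ : Cardinal.{u}} (hκ : ℵ₀ ≤ κ) (m : ℕ) {ι : Type u}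
    (S : ι → Set α) (hι : #ι ≤ succIter κ m) (hS : ∀ i, κ = #(S i))
    (hd : ∀ i j, i ≠ j → (S i ∩ S j).Subsingleton) :
    ∃ x : ι → α, (∀ i, x i ∈ S i) ∧ WellFounded (Prec S x) ∧
      ∀ i, {j | Prec S x j i}.encard ≤ (m + 2 : ℕ) := by
  induction m generalizing ι with
  | zero => exact exists_points_of_mk_le S hκ hι (fun i => (hS i).le) hd
  | succ m ih =>
    have hc : ℵ₀ ≤ succIter κ m := hκ.trans (succIter_le κ m)
    obtain ⟨_, _, hlt⟩ := exists_linearOrder_mk_Iio_lt ι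
    have hIic : ∀ a : ι, #(Set.Iic a) ≤ succIter κ m := by
      intro a
      rw [← Set.Iio_insert]
      refine mk_insert_le.trans (add_le_of_le hc ?_ (one_le_aleph0.trans hc))
      exact Order.lt_succ_iff.1 ((hlt a).trans_le hι)
    have hex : ∀ i : ι, ∃ a, i ∈ span S (Set.Iic a) := fun i =>
      ⟨i, subset_span S _ (Set.self_mem_Iic)⟩
    -- The level of `i` is the first initial segment whose closure contains `i`; every level has
    -- size at most `succIter κ m`.
    let ρ : ι → ι := fun i => wellFounded_lt.min {a | i ∈ span S (Set.Iic a)} (hex i)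
    have hρ : ∀ i, i ∈ span S (Set.Iic (ρ i)) := fun i =>
      wellFounded_lt.min_mem {a | i ∈ span S (Set.Iic a)} (hex i)
    have hρle : ∀ i a, i ∈ span S (Set.Iic a) → ρ i ≤ a := fun i a h =>
      not_lt.1 (wellFounded_lt.not_lt_min {a | i ∈ span S (Set.Iic a)} h)
    let U : ι → Set α := fun a => ⋃ j ∈ {j | ρ j < a}, S j
    -- A set with two points in sets of lower level would already belong to a smaller closure.
    have hU : ∀ i, (S i ∩ U (ρ i)).Subsingleton := by
      rintro i p ⟨hp, hpU⟩ q ⟨hq, hqU⟩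
      obtain ⟨j, hj, hpj⟩ := Set.mem_iUnion₂.1 hpU
      obtain ⟨j', hj', hqj⟩ := Set.mem_iUnion₂.1 hqU
      by_contra hne
      have h1 : j ∈ span S (Set.Iic (max (ρ j) (ρ j'))) :=
        span_mono S (Set.Iic_subset_Iic.2 (le_max_left _ _)) (hρ j)
      have h2 : j' ∈ span S (Set.Iic (max (ρ j) (ρ j'))) :=
        span_mono S (Set.Iic_subset_Iic.2 (le_max_right _ _)) (hρ j')
      exact (hρle i _ (mem_span_of_ne S _ h1 h2 hpj hqj hne hp hq)).not_gt (max_lt hj hj')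
    -- Deleting the points of lower levels costs each set at most one point and keeps new
    -- representatives out of lower sets. In return, each set gains at most one representative over
    -- those from its own level.
    let S' : ∀ a : ι, {i // ρ i = a} → Set α := fun a i => S i \ U a
    have hlevel : ∀ a : ι, ∃ x : {i // ρ i = a} → α, (∀ i, x i ∈ S' a i) ∧
        WellFounded (Prec (S' a) x) ∧ ∀ i, {j | Prec (S' a) x j i}.encard ≤ (m + 2 : ℕ) := by
      intro a
      refine ih (S' a) ?_ ?_ ?_
      · refine le_trans (mk_le_mk_of_subset (t := span S (Set.Iic a)) ?_)
          (mk_span_le S hc (fun i => (hS i).ge.trans (succIter_le κ m)) hd (hIic a))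
        rintro i rfl
        exact hρ i
      · rintro ⟨i, rfl⟩
        exact le_antisymm (le_mk_sdiff_of_subsingleton hκ (hS i).le (hU i))
          ((mk_le_mk_of_subset Set.sdiff_subset).trans (hS i).ge)
      · intro i j hij
        exact (hd i j (fun h => hij (Subtype.ext h))).anti
          (Set.inter_subset_inter Set.sdiff_subset Set.sdiff_subset)
    choose y hyS hywf hydeg using hlevel
    let x : ι → α := fun i => y (ρ i) ⟨i, rfl⟩
    have hxS' : ∀ i, x i ∈ S i \ U (ρ i) := fun i => hyS (ρ i) ⟨i, rfl⟩
    have hyx : ∀ a (i : {i // ρ i = a}), y a i = x i := by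
      rintro _ ⟨i, rfl⟩
      rfl
    have hprec : ∀ j i, Prec S x j i → ρ j < ρ i ∨
        ∃ h : ρ j = ρ i, Prec (S' (ρ i)) (y (ρ i)) ⟨j, h⟩ ⟨i, rfl⟩ := by
      rintro j i ⟨hne, hmem⟩
      rcases lt_trichotomy (ρ j) (ρ i) with h | h | h
      · exact Or.inl h
      · refine Or.inr ⟨h, fun he => hne (congrArg Subtype.val he), ?_⟩
        rw [hyx]
        exact ⟨hmem, fun hu => (hxS' j).2 ((congrArg U h).symm.subset hu)⟩
      · exact absurd (Set.mem_biUnion (show i ∈ {i | ρ i < ρ j} from h) hmem) (hxS' j).2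
    have hwf : WellFounded (Prec S x) := by
      have hacc : ∀ a, ∀ i : {i // ρ i = a}, Acc (Prec S x) i := by
        intro a
        induction a using WellFoundedLT.induction with
        | _ a iha =>
          intro i
          induction i using (hywf a).induction with
          | _ i ihi =>
            obtain ⟨i, rfl⟩ := i
            refine Acc.intro _ fun j hj => ?_
            rcases hprec j i hj with h | ⟨h, h'⟩
            · exact iha _ h ⟨j, rfl⟩
            · exact ihi _ h'
      exact ⟨fun i => hacc (ρ i) ⟨i, rfl⟩⟩
    have hxinj : Function.Injective x := by
      intro i j hij
      by_contra hne
      exact hwf.asymmetric (a := i) (b := j) ⟨hne, hij ▸ (hxS' j).1⟩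
        ⟨Ne.symm hne, hij ▸ (hxS' i).1⟩
    refine ⟨x, fun i => (hxS' i).1, hwf, fun i => ?_⟩
    have hsub : {j | Prec S x j i} ⊆ {j | ρ j < ρ i ∧ x j ∈ S i} ∪
        Subtype.val '' {j | Prec (S' (ρ i)) (y (ρ i)) j ⟨i, rfl⟩} := by
      intro j hj
      rcases hprec j i hj with h | ⟨h, h'⟩
      · exact Or.inl ⟨h, hj.2⟩
      · exact Or.inr ⟨_, h', rfl⟩
    have h1 : {j | ρ j < ρ i ∧ x j ∈ S i}.encard ≤ 1 := by
      rw [Set.encard_le_one_iff_subsingleton]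
      rintro j ⟨hj, hjS⟩ j' ⟨hj', hjS'⟩
      exact hxinj (hU i ⟨hjS, Set.mem_biUnion (show j ∈ {j | ρ j < ρ i} from hj) (hxS' j).1⟩
        ⟨hjS', Set.mem_biUnion (show j' ∈ {j | ρ j < ρ i} from hj') (hxS' j').1⟩)
    calc {j | Prec S x j i}.encard
        ≤ _ := Set.encard_le_encard hsub
      _ ≤ _ := Set.encard_union_le _ _
      _ ≤ 1 + ((m + 2 : ℕ) : ℕ∞) :=
        add_le_add h1 ((Set.encard_image_le _ _).trans (hydeg (ρ i) ⟨i, rfl⟩))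
      _ = ((m + 1 + 2 : ℕ) : ℕ∞) := by push_cast; ring

/-! ### Upper bound: greedy coloring of the representatives -/

/-- A coloring of at most `2 * N - 1` points extends to one more point (possibly left uncolored)
so that some color occurs exactly once. -/
theorem exists_color_encard_eq_one {ι : Type*} {N : ℕ} (D : Set ι) (hD : D.encard < (2 * N : ℕ))
    {i : ι} (hi : i ∉ D) (c : ι → Option (Fin N)) :
    ∃ o : Option (Fin N), ∃ z : Fin N,
      {j | (j = i ∧ o = some z) ∨ (j ∈ D ∧ c j = some z)}.encard = 1 := by
  classical
  by_cases h1 : ∃ z, {j | j ∈ D ∧ c j = some z}.encard = 1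
  · obtain ⟨z, hz⟩ := h1
    exact ⟨none, z, by simpa using hz⟩
  by_cases h0 : ∃ z, {j | j ∈ D ∧ c j = some z} = ∅
  · obtain ⟨z, hz⟩ := h0
    refine ⟨some z, z, ?_⟩
    rw [Set.encard_eq_one]
    refine ⟨i, Set.ext fun j => ⟨?_, ?_⟩⟩
    · rintro (⟨rfl, -⟩ | hj)
      · rfl
      · exact absurd (show j ∈ {j | j ∈ D ∧ c j = some z} from hj) (by simp [hz])
    · rintro rfl
      exact Or.inl ⟨rfl, rfl⟩
  push Not at h1 h0
  exfalso
  have hfin : D.Finite := Set.finite_of_encard_le_coe hD.le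
  lift D to Finset ι using hfin
  rw [Set.encard_coe_eq_coe_finsetCard, Nat.cast_lt] at hD
  have hz : ∀ z : Fin N, 2 ≤ (D.filter fun j => c j = some z).card := by
    intro z
    have e : {j | j ∈ (D : Set ι) ∧ c j = some z} =
        ((D.filter fun j => c j = some z : Finset ι) : Set ι) := by
      ext j; simp
    have h1z := h1 z
    have h0z := h0 z
    rw [e, Set.encard_coe_eq_coe_finsetCard] at h1z
    rw [e, Finset.coe_nonempty, ← Finset.card_pos] at h0z
    have : (D.filter fun j => c j = some z).card ≠ 1 := by exact_mod_cast h1z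
    omega
  have hsum : ∑ z : Fin N, (D.filter fun j => c j = some z).card ≤ D.card := by
    rw [← Finset.card_biUnion]
    · exact Finset.card_le_card (Finset.biUnion_subset.2 fun z _ => Finset.filter_subset _ _)
    · intro z _ z' _ hne
      refine Finset.disjoint_filter.2 fun j _ h h' => hne ?_
      simpa using h.symm.trans h'
  have := Finset.sum_le_sum fun (z : Fin N) (_ : z ∈ Finset.univ) => hz z
  simp at this
  omega

theorem exists_isWeakColoring {α : Type u} {κ : Cardinal.{u}} (hκ : ℵ₀ ≤ κ) (m : ℕ)
    {A : Set (Set α)} (hA : IsSystem (succIter κ m) κ 2 A) :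
    ∃ f : α → Option (ULift.{u} (Fin (m / 2 + 2))), IsWeakColoring A f := by
  classical
  obtain ⟨x, hx, hwf, hdeg⟩ := exists_points hκ m (fun i : A => (i : Set α)) hA.card_eq.le
    (fun i => (hA.card_mem i i.2).symm) fun i j hij => by
      have := hA.card_inter_lt i i.2 j j.2 fun h => hij (Subtype.ext h)
      intro p hp q hq
      by_contra hne
      exact this.not_ge (two_le_iff.2 ⟨⟨p, hp⟩, ⟨q, hq⟩, fun h => hne (congrArg Subtype.val h)⟩)
  have hinj : Function.Injective x := by
    intro i j hij
    by_contra hne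
    exact hwf.asymmetric (a := i) (b := j) ⟨hne, hij ▸ hx j⟩ ⟨Ne.symm hne, hij ▸ hx i⟩
  obtain ⟨c, hc⟩ := exists_forall_of_wellFounded hwf
    (fun i (c : A → Option (Fin (m / 2 + 2))) o => ∃ z,
      {j | (j = i ∧ o = some z) ∨ (Prec (fun i : A => (i : Set α)) x j i ∧ c j = some z)}.encard
        = 1)
    (by
      rintro i c c' o hcc ⟨z, hz⟩
      refine ⟨z, ?_⟩
      rw [← hz]
      congr 1
      ext j
      simp only [Set.mem_ofPred_eq]
      refine or_congr Iff.rfl (and_congr_right fun hj => ?_)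
      rw [hcc j hj])
    -- The count is `m + 2 < 2 * (m / 2 + 2)`, for either parity of `m`.
    (fun i c => exists_color_encard_eq_one {j | Prec (fun i : A => (i : Set α)) x j i}
      ((hdeg i).trans_lt (by norm_cast; omega)) (fun h => h.1 rfl) c)
  let f : α → Option (ULift.{u} (Fin (m / 2 + 2))) := fun p =>
    if h : ∃ i, x i = p then (c h.choose).map ULift.up else none
  have hfx : ∀ i, f (x i) = (c i).map ULift.up := by
    intro i
    have h : ∃ j, x j = x i := ⟨i, rfl⟩
    have : f (x i) = (c h.choose).map ULift.up := dif_pos h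
    rw [this, hinj h.choose_spec]
  have hf : ∀ p, f p ≠ none → ∃ i, x i = p := by
    intro p hp
    by_contra h
    exact hp (dif_neg h)
  refine ⟨f, ?_, ?_⟩
  · intro p hp
    obtain ⟨i, rfl⟩ := hf p hp
    exact ⟨i, i.2, hx i⟩
  · intro T hT
    obtain ⟨z, hz⟩ := hc ⟨T, hT⟩
    refine ⟨⟨z⟩, ?_⟩
    rw [← hz, ← hinj.injOn.encard_image]
    congr 1
    ext p
    constructor
    · rintro ⟨hpT, hp⟩
      obtain ⟨i, rfl⟩ := hf p (by simp [show f p = _ from hp])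
      have hci : c i = some z := by
        have := (hfx i).symm.trans hp
        obtain ⟨a, ha, hb⟩ := Option.map_eq_some_iff.1 this
        rw [ha]
        exact congrArg some (ULift.up_injective hb)
      by_cases h : i = ⟨T, hT⟩
      · exact ⟨i, Or.inl ⟨h, h ▸ hci⟩, rfl⟩
      · exact ⟨i, Or.inr ⟨⟨h, hpT⟩, hci⟩, rfl⟩
    · rintro ⟨i, ⟨rfl, h⟩ | ⟨h, h'⟩, rfl⟩
      · exact ⟨hx ⟨T, hT⟩, (hfx _).trans (by simp [h])⟩
      · exact ⟨h.2, (hfx _).trans (by simp [h'])⟩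

theorem weakChromaticNumber_le {α : Type u} {κ : Cardinal.{u}} (hκ : ℵ₀ ≤ κ) (m : ℕ)
    {A : Set (Set α)} (hA : IsSystem (succIter κ m) κ 2 A) :
    weakChromaticNumber A ≤ ((m / 2 + 2 : ℕ) : Cardinal.{u}) :=
  csInf_le' ⟨ULift.{u} (Fin (m / 2 + 2)), by simp, exists_isWeakColoring hκ m hA⟩

/-! ### Lower bound: the affine plane -/

/-- The sets `ed e` are forcing with `M` extra points for the colors `C`: for every set `J` of
colors, one can attach at most `M` extra colors to every edge so that every partial coloring of the
points with colors in `J` leaves an edge on which, extra colors included, no color occurs exactly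
once. -/
def Forces {Pt Ed : Type*} (C : Type) [DecidableEq C] (ed : Ed → Set Pt) (M : ℕ) : Prop :=
  ∀ J : Finset C, ∃ σ : Ed → List C, (∀ e, (σ e).length ≤ M ∧ ∀ c ∈ σ e, c ∈ J) ∧
    ∀ f : Pt → Option C, (∀ p c, f p = some c → c ∈ J) →
      ∃ e, ∀ c, ((σ e).count c : ℕ∞) + (ed e ∩ {p | f p = some c}).encard ≠ 1

/-- The lines of the affine plane over `K`. -/
def planeLine {K : Type*} [Field K] : Option K × K → Set (K × K)
  | (none, c) => {p | p.1 = c}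
  | (some a, b) => {p | p.2 = a * p.1 + b}

theorem planeLine_inter {K : Type*} [Field K] (e e' : Option K × K) (h : e ≠ e') :
    (planeLine e ∩ planeLine e').Subsingleton := by
  rintro ⟨x, y⟩ ⟨h1, h2⟩ ⟨x', y'⟩ ⟨h3, h4⟩
  obtain ⟨_ | a, b⟩ := e <;> obtain ⟨_ | a', b'⟩ := e' <;>
    simp only [planeLine, Set.mem_ofPred_eq] at h1 h2 h3 h4
  · exact absurd (by rw [← h1, ← h2]) h
  · subst h1 h2 h3 h4
    rfl
  · subst h2 h1 h4 h3
    rfl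
  · by_cases hx : x = x'
    · subst hx
      rw [h1, h3]
    · have hz : (a - a') * (x - x') = 0 := by linear_combination h2 - h1 + h3 - h4
      rcases mul_eq_zero.1 hz with h0 | h0
      · have ha : a = a' := sub_eq_zero.1 h0
        subst ha
        have hb : b = b' := by linear_combination h2 - h1
        exact absurd (by rw [hb]) h
      · exact absurd (sub_eq_zero.1 h0) hx

theorem mk_planeLine {K : Type u} [Field K] (e : Option K × K) : #(planeLine e) = #K := by
  obtain ⟨_ | a, b⟩ := e
  · exact mk_congr ⟨fun p => p.1.2, fun y => ⟨(b, y), rfl⟩, by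
      rintro ⟨⟨x, y⟩, rfl : x = b⟩; rfl, fun y => rfl⟩
  · exact mk_congr ⟨fun p => p.1.1, fun x => ⟨(x, a * x + b), rfl⟩, by
      rintro ⟨⟨x, y⟩, rfl : y = a * x + b⟩; rfl, fun y => rfl⟩

/-- Two points of `Y` span a line meeting `Y` at least twice; if `Y` has at most one point, some
vertical line misses it. -/
theorem exists_planeLine_encard_ne_one {K : Type*} [Field K] (Y : Set (K × K)) :
    ∃ e, (planeLine e ∩ Y).encard ≠ 1 := by
  by_cases hY : Y.Subsingleton
  · rcases hY.eq_empty_or_singleton with rfl | ⟨p, rfl⟩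
    · exact ⟨(none, 0), by simp⟩
    · refine ⟨(none, p.1 + 1), ?_⟩
      have : planeLine (none, p.1 + 1) ∩ {p} = ∅ := by
        ext q
        simp only [planeLine, Set.mem_inter_iff, Set.mem_ofPred_eq, Set.mem_singleton_iff,
          Set.mem_empty_iff_false, iff_false, not_and]
        rintro h rfl
        simp at h
      simp [this]
  · obtain ⟨⟨x, y⟩, hp, ⟨x', y'⟩, hq, hne⟩ := Set.not_subsingleton_iff.1 hY
    suffices ∃ e : Option K × K, (x, y) ∈ planeLine e ∧ (x', y') ∈ planeLine e by
      obtain ⟨e, h1, h2⟩ := this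
      have hlt : 1 < (planeLine e ∩ Y).encard :=
        Set.one_lt_encard_iff.2 ⟨_, _, ⟨h1, hp⟩, ⟨h2, hq⟩, hne⟩
      exact ⟨e, hlt.ne'⟩
    by_cases hx : x = x'
    · exact ⟨(none, x), rfl, hx.symm⟩
    · refine ⟨(some ((y - y') / (x - x')), y - (y - y') / (x - x') * x), ?_, ?_⟩
      · simp [planeLine]
      · have : x - x' ≠ 0 := sub_ne_zero.2 hx
        simp only [planeLine, Set.mem_ofPred_eq]
        field_simp
        ring

theorem forces_planeLine (K : Type*) [Field K] (l : ℕ) :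
    Forces (Fin (l + 1)) (planeLine (K := K)) (2 * l) := by
  classical
  intro J
  -- The color `d` is the one not attached to the lines. For empty `J` it is arbitrary, and nothing
  -- is colored.
  obtain ⟨d, hd⟩ : ∃ d, J.Nonempty → d ∈ J := by
    rcases J.eq_empty_or_nonempty with rfl | ⟨d, hd⟩
    · exact ⟨0, by simp⟩
    · exact ⟨d, fun _ => hd⟩
  have hcard : (J.erase d).card ≤ l := by
    have := Finset.card_le_univ (insert d (J.erase d))
    rw [Finset.card_insert_of_notMem (Finset.notMem_erase d J), Fintype.card_fin] at this
    omega
  refine ⟨fun _ => (J.erase d).toList ++ (J.erase d).toList, fun e => ⟨?_, ?_⟩, fun f hf => ?_⟩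
  · simp only [List.length_append, Finset.length_toList]
    omega
  · intro c hc
    simp only [List.mem_append, Finset.mem_toList, or_self] at hc
    exact Finset.mem_of_mem_erase hc
  · obtain ⟨e, he⟩ := exists_planeLine_encard_ne_one {p | f p = some d}
    refine ⟨e, fun c => ?_⟩
    by_cases hcd : c = d
    · subst hcd
      have : ((J.erase c).toList ++ (J.erase c).toList).count c = 0 :=
        List.count_eq_zero.2 (by simp)
      simpa [this] using he
    by_cases hc : c ∈ J
    · have h1 : 1 ≤ (J.erase d).toList.count c :=
        List.one_le_count_iff.2 (by simp [hc, hcd])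
      refine (lt_of_lt_of_le ?_ le_self_add).ne'
      rw [List.count_append]
      norm_cast
      omega
    · have h0 : ((J.erase d).toList ++ (J.erase d).toList).count c = 0 :=
        List.count_eq_zero.2 (by simp [hc])
      have h2 : {p | f p = some c} = ∅ := by
        ext p
        simpa using fun h => hc (hf p c h)
      simp [h0, h2]

/-! ### Lower bound: copies with attached points -/

/-- Indices of copies of a set system with points `Pt` and edges `Ed`: a copy is given by an
element of `Ed` (which serves to make many copies) and a partial function that attaches to edges
points of earlier copies. -/
abbrev CopyIndex (Pt Ed : Type u) : Type u :=
  WType (α := Ed × (Ed → Option Pt)) fun a => {e // (a.2 e).isSome}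

namespace CopyIndex

variable {Pt Ed : Type u}

/-- The point of an earlier copy attached to the edge `e`. -/
def attach : CopyIndex Pt Ed → Ed → Option (CopyIndex Pt Ed × Pt)
  | ⟨a, s⟩, e => if h : (a.2 e).isSome then some (s ⟨e, h⟩, (a.2 e).get h) else none

/-- The multiplicity label of a copy. -/
def label : CopyIndex Pt Ed → Ed
  | ⟨a, _⟩ => a.1

/-- The copy with given label and attached points. -/
def ofAttach (i : Ed) (t : Ed → Option (CopyIndex Pt Ed × Pt)) : CopyIndex Pt Ed :=
  WType.mk (i, fun e => (t e).map Prod.snd) fun e => ((t e.1).get (by simpa using e.2)).1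

@[simp] theorem label_ofAttach (i : Ed) (t : Ed → Option (CopyIndex Pt Ed × Pt)) :
    label (ofAttach i t) = i := rfl

@[simp] theorem attach_ofAttach (i : Ed) (t : Ed → Option (CopyIndex Pt Ed × Pt)) :
    attach (ofAttach i t) = t := by
  funext e
  rcases h : t e with _ | z
  · simp [ofAttach, attach, h]
  · simp [ofAttach, attach, h]

theorem wellFounded_attach :
    WellFounded fun w' w : CopyIndex Pt Ed => ∃ e p, attach w e = some (w', p) := by
  refine ⟨fun w => ?_⟩
  induction w with
  | mk a s ih =>
    refine Acc.intro _ ?_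
    rintro w' ⟨e, p, h⟩
    simp only [attach] at h
    split_ifs at h with he
    obtain ⟨rfl, -⟩ := Prod.mk.inj (Option.some.inj h)
    exact ih _

/-- The W-type is the initial algebra of its functor, so it suffices that `2 ^ #Ed` bounds the size
of the functor applied to a set of size `2 ^ #Ed`. -/
theorem mk_le [Infinite Ed] (h : #Pt ≤ 2 ^ #Ed) : #(CopyIndex Pt Ed) ≤ 2 ^ #Ed := by
  have hE : ℵ₀ ≤ #Ed := infinite_iff.1 ‹_›
  have h2 : ℵ₀ ≤ (2 : Cardinal.{u}) ^ #Ed := hE.trans (cantor _).le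
  have hpow : ((2 : Cardinal.{u}) ^ #Ed) ^ #Ed = 2 ^ #Ed := by
    rw [← power_mul, mul_eq_self hE]
  refine WType.cardinalMk_le_of_le ?_
  calc sum (fun a : Ed × (Ed → Option Pt) => ((2 : Cardinal.{u}) ^ #Ed) ^ #{e // (a.2 e).isSome})
      ≤ sum fun _ : Ed × (Ed → Option Pt) => (2 : Cardinal.{u}) ^ #Ed := by
        refine sum_le_sum _ _ fun a => ?_
        exact (power_le_power_left (aleph0_pos.trans_le h2).ne' (mk_subtype_le _)).trans hpow.le
    _ = #Ed * (#Pt + 1) ^ #Ed * 2 ^ #Ed := by simp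
    _ ≤ 2 ^ #Ed * 2 ^ #Ed * 2 ^ #Ed := by
        gcongr
        · exact (cantor _).le
        · exact (power_le_power_right (add_le_of_le h2 h (one_le_aleph0.trans h2))).trans hpow.le
    _ = 2 ^ #Ed := by rw [mul_eq_self h2, mul_eq_self h2]

/-- No point is attached to two edges of the copy. -/
def Inj (w : CopyIndex Pt Ed) : Prop :=
  ∀ e e' z, attach w e = some z → attach w e' = some z → e = e'

/-- The edges of all copies, with the attached points added. -/
def edge (ed : Ed → Set Pt) (x : CopyIndex Pt Ed × Ed) : Set (CopyIndex Pt Ed × Pt) :=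
  {z | (z.1 = x.1 ∧ z.2 ∈ ed x.2) ∨ (Inj x.1 ∧ attach x.1 x.2 = some z)}

/-- Within a copy, `Inj` prevents attached points from creating new intersections. For different
copies a common point is the attached point of one of the two edges. Two distinct common points
would make each copy earlier than the other. -/
theorem edge_inter (ed : Ed → Set Pt) (hd : ∀ e e', e ≠ e' → (ed e ∩ ed e').Subsingleton)
    (x x' : CopyIndex Pt Ed × Ed) (hne : x ≠ x') : (edge ed x ∩ edge ed x').Subsingleton := by
  obtain ⟨w, e⟩ := x
  obtain ⟨w', e'⟩ := x'
  have hasym : ∀ {v v' : CopyIndex Pt Ed} {e e' : Ed} {p p' : Pt},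
      attach v e = some (v', p) → attach v' e' = some (v, p') → False := fun {v v'} _ _ _ _ h h' =>
    wellFounded_attach.asymmetric (a := v) (b := v') ⟨_, _, h'⟩ ⟨_, _, h⟩
  rintro ⟨v, p⟩ ⟨h1, h2⟩ ⟨v', q⟩ ⟨h3, h4⟩
  simp only [edge, Set.mem_ofPred_eq] at h1 h2 h3 h4
  by_cases hw : w = w'
  · subst hw
    have hee : e ≠ e' := fun h => hne (by rw [h])
    have key : ∀ v p, ((v = w ∧ p ∈ ed e) ∨ (Inj w ∧ attach w e = some (v, p))) →
        ((v = w ∧ p ∈ ed e') ∨ (Inj w ∧ attach w e' = some (v, p))) →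
        v = w ∧ p ∈ ed e ∩ ed e' := by
      rintro v p (⟨rfl, h⟩ | ⟨hi, h⟩) (⟨h0, h'⟩ | ⟨hi', h'⟩)
      · exact ⟨rfl, h, h'⟩
      · exact (hasym h' h').elim
      · subst h0
        exact (hasym h h).elim
      · exact absurd (hi _ _ _ h h') hee
    obtain ⟨rfl, hp⟩ := key v p h1 h2
    obtain ⟨rfl, hq⟩ := key v' q h3 h4
    rw [hd e e' hee hp hq]
  · rcases h1 with ⟨rfl, h1⟩ | ⟨-, h1⟩ <;> rcases h2 with ⟨h2w, h2⟩ | ⟨-, h2⟩ <;>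
      rcases h3 with ⟨h3w, h3⟩ | ⟨-, h3⟩ <;> rcases h4 with ⟨h4w, h4⟩ | ⟨-, h4⟩
    · exact absurd h2w hw
    · exact absurd h2w hw
    · exact absurd h2w hw
    · exact absurd h2w hw
    · exact absurd (h3w.symm.trans h4w) hw
    · exact Option.some.inj (h2.symm.trans h4)
    · subst h4w
      exact (hasym h3 h2).elim
    · exact Option.some.inj (h2.symm.trans h4)
    · exact absurd (h3w.symm.trans h4w) hw
    · subst h2w h3w
      exact (hasym h1 h4).elim
    · exact Option.some.inj (h1.symm.trans h3)
    · exact Option.some.inj (h1.symm.trans h3)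
    · exact absurd (h3w.symm.trans h4w) hw
    · exact Option.some.inj (h2.symm.trans h4)
    · exact Option.some.inj (h1.symm.trans h3)
    · exact Option.some.inj (h1.symm.trans h3)

theorem edge_eq_of_attach_none (ed : Ed → Set Pt) {w : CopyIndex Pt Ed} {e : Ed}
    (h : attach w e = none) : edge ed (w, e) = Prod.mk w '' ed e := by
  ext ⟨v, p⟩
  simp [edge, h, eq_comm, and_comm]

theorem edge_eq_of_attach_some (ed : Ed → Set Pt) {w : CopyIndex Pt Ed} (hw : Inj w) {e : Ed}
    {z : CopyIndex Pt Ed × Pt} (h : attach w e = some z) :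
    edge ed (w, e) = insert z (Prod.mk w '' ed e) := by
  ext ⟨v, p⟩
  simp [edge, h, hw, eq_comm, and_comm, or_comm]

theorem mk_edge {κ : Cardinal.{u}} (hκ : ℵ₀ ≤ κ) (ed : Ed → Set Pt) (hed : ∀ e, #(ed e) = κ)
    (x : CopyIndex Pt Ed × Ed) : #(edge ed x) = κ := by
  obtain ⟨w, e⟩ := x
  have h1 : #(Prod.mk w '' ed e) = κ := by
    rw [mk_image_eq (Prod.mk_right_injective w), hed]
  refine le_antisymm ?_ (h1.symm.le.trans (mk_le_mk_of_subset ?_))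
  · have : edge ed (w, e) ⊆ Prod.mk w '' ed e ∪ {z | attach w e = some z} := by
      rintro ⟨v, p⟩ (⟨rfl, h⟩ | ⟨-, h⟩)
      · exact Or.inl ⟨p, h, rfl⟩
      · exact Or.inr h
    refine (mk_le_mk_of_subset this).trans ((mk_union_le _ _).trans (add_le_of_le hκ h1.le ?_))
    refine (mk_le_one_iff_set_subsingleton.2 ?_).trans (one_le_aleph0.trans hκ)
    intro z hz z' hz'
    exact Option.some.inj (Eq.trans (Eq.symm hz) hz')
  · rintro _ ⟨p, hp, rfl⟩
    exact Or.inl ⟨rfl, hp⟩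

end CopyIndex

theorem mk_setOf_exists_mem_lt {X : Type u} {C : Type*} {μ : Cardinal.{u}} (hμ : ℵ₀ ≤ μ)
    (f : X → Option C) (s : Finset C) (h : ∀ c ∈ s, #{x | f x = some c} < μ) :
    #{x | ∃ c ∈ s, f x = some c} < μ := by
  classical
  induction s using Finset.induction_on with
  | empty => simpa using aleph0_pos.trans_le hμ
  | insert c s _ ih =>
    have hsub : {x | ∃ d ∈ insert c s, f x = some d} ⊆
        {x | f x = some c} ∪ {x | ∃ d ∈ s, f x = some d} := by
      rintro x ⟨d, hd, hx⟩
      rcases Finset.mem_insert.1 hd with rfl | hd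
      · exact Or.inl hx
      · exact Or.inr ⟨d, hd, hx⟩
    exact (mk_le_mk_of_subset hsub).trans_lt ((mk_union_le _ _).trans_lt (add_lt_of_lt hμ
      (h c (Finset.mem_insert_self c s)) (ih fun d hd => h d (Finset.mem_insert_of_mem hd))))

namespace CopyIndex

/-- Every edge receives a point colored by the head of its list. Each color of `J` has enough points
for an injective choice, and points of different colors differ, so no point serves two edges. -/
theorem exists_attach {Ed : Type u} {X : Type u} {C : Type*} (f : X → Option C)
    (J : Finset C) (hJ : ∀ c ∈ J, #Ed ≤ #{x | f x = some c}) (σ : Ed → List C)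
    (hσ : ∀ e, ∀ c ∈ σ e, c ∈ J) :
    ∃ τ : Ed → Option X, (∀ e, σ e = [] → τ e = none) ∧
      (∀ e c t, σ e = c :: t → ∃ z, τ e = some z ∧ f z = some c) ∧
      ∀ e e' z, τ e = some z → τ e' = some z → e = e' := by
  classical
  let g : ∀ c ∈ J, Ed ↪ {x | f x = some c} := fun c hc => ((le_def _ _).1 (hJ c hc)).some
  let τ : Ed → Option X := fun e =>
    (σ e).head?.bind fun c => if h : c ∈ J then some (g c h e).1 else none
  have hτ : ∀ e c t, σ e = c :: t → ∃ h : c ∈ J, τ e = some (g c h e).1 := by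
    intro e c t h
    have hc : c ∈ J := hσ e c (by simp [h])
    exact ⟨hc, by simp [τ, h, hc]⟩
  have hnil : ∀ e, σ e = [] → τ e = none := fun e h => by simp [τ, h]
  refine ⟨τ, hnil, fun e c t h => ?_, fun e e' z hz hz' => ?_⟩
  · obtain ⟨hc, he⟩ := hτ e c t h
    exact ⟨_, he, (g c hc e).2⟩
  · rcases h : σ e with _ | ⟨c, t⟩
    · simp [hnil e h] at hz
    rcases h' : σ e' with _ | ⟨c', t'⟩
    · simp [hnil e' h'] at hz'
    obtain ⟨hc, he⟩ := hτ e c t h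
    obtain ⟨hc', he'⟩ := hτ e' c' t' h'
    have h1 : (g c hc e).1 = z := Option.some.inj (he.symm.trans hz)
    have h2 : (g c' hc' e').1 = z := Option.some.inj (he'.symm.trans hz')
    have hcc : c = c' := by
      have e1 : f z = some c := h1 ▸ (g c hc e).2
      have e2 : f z = some c' := h2 ▸ (g c' hc' e').2
      exact Option.some.inj (e1.symm.trans e2)
    subst hcc
    exact (g c hc).injective (Subtype.ext (h1.trans h2.symm))

theorem encard_image_inter {Pt Ed : Type u} {C : Type*} (w : CopyIndex Pt Ed) (s : Set Pt)
    (f : CopyIndex Pt Ed × Pt → Option C) (c : C) :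
    (Prod.mk w '' s ∩ {z | f z = some c}).encard = (s ∩ {p | f (w, p) = some c}).encard := by
  refine Eq.trans (congrArg Set.encard (Set.ext ?_))
    (Prod.mk_right_injective w).injOn.encard_image
  rintro ⟨v, p⟩
  simp only [Set.mem_inter_iff, Set.mem_image, Prod.mk.injEq, Set.mem_ofPred_eq]
  constructor
  · rintro ⟨⟨q, hq, rfl, rfl⟩, h⟩
    exact ⟨q, ⟨hq, h⟩, rfl, rfl⟩
  · rintro ⟨q, ⟨hq, h⟩, rfl, rfl⟩
    exact ⟨⟨q, hq, rfl, rfl⟩, h⟩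

/-- Attaching points of earlier copies trades one extra color for one extra point. -/
theorem forces_edge {Pt Ed : Type u} [Infinite Ed] {C : Type} [Fintype C] [DecidableEq C]
    {ed : Ed → Set Pt} {M : ℕ} (hF : Forces C ed (M + 1)) : Forces C (edge ed) M := by
  classical
  have hE : ℵ₀ ≤ #Ed := infinite_iff.1 ‹_›
  -- A label now codes a multiplicity and a guess of the set of frequent colors; the extra colors
  -- must be fixed before the coloring is known.
  obtain ⟨φ⟩ : Nonempty (Ed ≃ Ed × Finset C) := by
    have h : lift.{0} #Ed = lift.{u} #(Finset C) * lift.{0} #Ed := by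
      refine (mul_eq_right (by simp) ?_ ?_).symm
      · exact (lift_lt_aleph0.2 (lt_aleph0_of_finite _)).le.trans (by simp)
      · simp
    refine lift_mk_eq'.1 ?_
    simpa [mul_comm] using h
  choose σ hσ hw using hF
  intro J
  refine ⟨fun x => (σ (J ∩ (φ (label x.1)).2) x.2).tail, fun x => ⟨?_, ?_⟩, fun f hf => ?_⟩
  · have := (hσ (J ∩ (φ (label x.1)).2) x.2).1
    simp only [List.length_tail]
    omega
  · intro c hc
    exact Finset.mem_of_mem_inter_left
      ((hσ (J ∩ (φ (label x.1)).2) x.2).2 c (List.mem_of_mem_tail hc))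
  -- `J'` collects the frequent colors. All other colors together occupy fewer than `#Ed` points, so
  -- one of the `#Ed` copies with the same attachments and the guess `J'` avoids them.
  · let J' : Finset C := Finset.univ.filter fun c => #Ed ≤ #{p | f p = some c}
    have hJ' : ∀ c, c ∈ J' ↔ #Ed ≤ #{p | f p = some c} := fun c => by simp [J']
    have hJJ : J ∩ J' = J' := by
      refine Finset.inter_eq_right.2 fun c hc => ?_
      obtain ⟨p, hp⟩ := mk_set_ne_zero_iff.1
        ((aleph0_pos.trans_le (hE.trans ((hJ' c).1 hc))).ne')
      exact hf p c hp
    have hN : #{p | ∃ c ∈ J'ᶜ, f p = some c} < #Ed :=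
      mk_setOf_exists_mem_lt hE f _ fun c hc => by
        rw [Finset.mem_compl, hJ', not_le] at hc
        exact hc
    obtain ⟨τ, hτnil, hτcons, hτinj⟩ := exists_attach f J' (fun c hc => (hJ' c).1 hc) (σ J')
      fun e => (hσ J' e).2
    let w : Ed → CopyIndex Pt Ed := fun k => ofAttach (φ.symm (k, J')) τ
    have hwinj : Function.Injective w := by
      intro k k' h
      have h' := congrArg label h
      simp only [w, label_ofAttach] at h'
      exact congrArg Prod.fst (φ.symm.injective h')
    obtain ⟨k, hk⟩ : ∃ k, ∀ p, (w k, p) ∉ {p | ∃ c ∈ J'ᶜ, f p = some c} := by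
      by_contra! hcon
      choose p hp using hcon
      refine hN.not_ge (mk_le_of_injective (f := fun k => ⟨(w k, p k), hp k⟩) fun k k' h => ?_)
      exact hwinj (congrArg (fun z => z.1.1) h)
    obtain ⟨e, he⟩ := hw J' (fun p => f (w k, p)) fun p c hc => by
      by_contra h
      exact hk p ⟨c, Finset.mem_compl.2 h, hc⟩
    refine ⟨(w k, e), fun c => ?_⟩
    have hattach : attach (w k) = τ := attach_ofAttach _ _
    have hInj : Inj (w k) := by
      intro e e' z
      rw [hattach]
      exact hτinj e e' z
    have hlabel : J ∩ (φ (label (w k))).2 = J' := by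
      simp only [w, label_ofAttach, Equiv.apply_symm_apply, hJJ]
    simp only [hlabel]
    have hec := he c
    rcases hl : σ J' e with _ | ⟨c₀, t⟩
    · rw [edge_eq_of_attach_none ed (by rw [hattach, hτnil e hl]), encard_image_inter]
      rw [hl] at hec
      exact hec
    · obtain ⟨z, hz, hfz⟩ := hτcons e c₀ t hl
      have hz' : attach (w k) e = some z := by rw [hattach, hz]
      have hzw : z ∉ Prod.mk (w k) '' ed e ∩ {z | f z = some c} := by
        rintro ⟨⟨p, -, rfl⟩, -⟩
        have h : ∃ e p, attach (w k) e = some (w k, p) := ⟨e, p, hz'⟩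
        exact wellFounded_attach.asymmetric (a := w k) (b := w k) h h
      rw [edge_eq_of_attach_some ed hInj hz']
      rw [hl] at hec
      by_cases hc : c₀ = c
      · subst hc
        rw [Set.insert_inter_of_mem (show z ∈ {z | f z = some c₀} from hfz),
          Set.encard_insert_of_notMem hzw, encard_image_inter]
        simpa [add_assoc, add_comm, add_left_comm] using hec
      · have hfz' : z ∉ {z | f z = some c} := fun h =>
          hc (Option.some.inj (hfz.symm.trans h))
        rw [Set.insert_inter_of_notMem hfz', encard_image_inter]
        simpa [List.count_cons, hc] using hec

end CopyIndex

/-! ### Lower bound: iteration and padding -/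

theorem exists_forces {κ : Cardinal.{u}} (hκ : ℵ₀ ≤ κ) (l k M : ℕ) (hk : k + M = 2 * l) :
    ∃ (Pt Ed : Type u) (ed : Ed → Set Pt), ℵ₀ ≤ #Ed ∧ #Pt ≤ 2 ^ #Ed ∧ #Ed ≤ bethFrom κ k ∧
      (∀ e, #(ed e) = κ) ∧ (∀ e e', e ≠ e' → (ed e ∩ ed e').Subsingleton) ∧
      Forces (Fin (l + 1)) ed M := by
  induction k generalizing M with
  | zero =>
    obtain rfl : M = 2 * l := by omega
    have : Infinite κ.out := infinite_iff.2 (by simpa using hκ)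
    obtain ⟨_⟩ := Infinite.nonempty_field (α := κ.out)
    have hEd : #(Option κ.out × κ.out) = κ := by
      simp only [mk_prod, mk_option, lift_id, mk_out]
      rw [add_eq_left hκ (one_le_aleph0.trans hκ), mul_eq_self hκ]
    refine ⟨κ.out × κ.out, Option κ.out × κ.out, planeLine, ?_, ?_, ?_, fun e => ?_,
      planeLine_inter, forces_planeLine _ l⟩
    · rwa [hEd]
    · rw [hEd, mk_prod, lift_id, mk_out, mul_eq_self hκ]
      exact (cantor _).le
    · exact hEd.le
    · rw [mk_planeLine, mk_out]
  | succ k ih =>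
    obtain ⟨Pt, Ed, ed, hE, hPt, hEd, hed, hd, hF⟩ := ih (M + 1) (by omega)
    have : Infinite Ed := infinite_iff.2 hE
    have h2 : ℵ₀ ≤ (2 : Cardinal.{u}) ^ #Ed := hE.trans (cantor _).le
    have hI := CopyIndex.mk_le hPt
    obtain ⟨e₀⟩ : Nonempty Ed := inferInstance
    have hle : #Ed ≤ #(CopyIndex Pt Ed × Ed) :=
      mk_le_of_injective (Prod.mk_right_injective (CopyIndex.ofAttach e₀ fun _ => none))
    refine ⟨CopyIndex Pt Ed × Pt, CopyIndex Pt Ed × Ed, CopyIndex.edge ed, hE.trans hle, ?_, ?_,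
      CopyIndex.mk_edge hκ ed hed, CopyIndex.edge_inter ed hd, CopyIndex.forces_edge hF⟩
    · refine le_trans ?_ (power_le_power_left two_ne_zero hle)
      rw [mk_prod, lift_id, lift_id, ← mul_eq_self h2]
      exact mul_le_mul' hI hPt
    · refine le_trans ?_ (power_le_power_left two_ne_zero hEd)
      rw [mk_prod, lift_id, lift_id, ← mul_eq_self h2]
      exact mul_le_mul' hI (cantor _).le

theorem isSystem_range {α ι : Type u} {κ : Cardinal.{u}} (hκ : ℵ₀ ≤ κ) (F : ι → Set α)
    (hF : ∀ i, #(F i) = κ) (hd : ∀ i j, i ≠ j → (F i ∩ F j).Subsingleton) :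
    IsSystem #ι κ 2 (Set.range F) := by
  refine ⟨mk_range_eq F fun i j hij => ?_, ?_, ?_⟩
  · by_contra hne
    have h := hd i j hne
    rw [← hij, Set.inter_self, ← mk_le_one_iff_set_subsingleton, hF] at h
    exact (one_lt_aleph0.trans_le hκ).not_ge h
  · rintro _ ⟨i, rfl⟩
    exact hF i
  · rintro _ ⟨i, rfl⟩ _ ⟨j, rfl⟩ hne
    refine (mk_le_one_iff_set_subsingleton.2 (hd i j fun h => hne (by rw [h]))).trans_lt ?_
    exact one_lt_two

theorem le_mk_of_forces {α C : Type u} {Pt Ed : Type u} {ed : Ed → Set Pt} {l : ℕ}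
    (hF : Forces (Fin (l + 1)) ed 0) {A : Set (Set α)} (g : Pt → α) (hg : Function.Injective g)
    (hA : ∀ e, g '' ed e ∈ A) {f : α → Option C} (hf : IsWeakColoring A f) :
    ((l + 2 : ℕ) : Cardinal.{u}) ≤ #C := by
  by_contra! hlt
  obtain ⟨n, hn⟩ := lt_aleph0.1 (hlt.trans natCast_lt_aleph0)
  have : Finite C := lt_aleph0_iff_finite.1 (hlt.trans natCast_lt_aleph0)
  have := Fintype.ofFinite C
  rw [mk_fintype, Nat.cast_lt] at hlt
  obtain ⟨φ⟩ : Nonempty (C ↪ Fin (l + 1)) :=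
    Function.Embedding.nonempty_of_card_le (by rw [Fintype.card_fin]; omega)
  obtain ⟨σ, hσ, hw⟩ := hF Finset.univ
  obtain ⟨e, he⟩ := hw (fun p => (f (g p)).map φ) fun _ _ _ => Finset.mem_univ _
  obtain ⟨c, hc⟩ := hf.2 _ (hA e)
  refine he (φ c) ?_
  have hnil : σ e = [] := List.length_eq_zero_iff.1 (Nat.le_zero.1 (hσ e).1)
  rw [← hc, hnil, List.count_nil, Nat.cast_zero, zero_add, ← hg.injOn.encard_image]
  congr 1
  ext p
  simp only [Set.mem_image, Set.mem_inter_iff, Set.mem_ofPred_eq, Option.map_eq_some_iff,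
    φ.injective.eq_iff, exists_eq_right]
  constructor
  · rintro ⟨q, ⟨hq, hq'⟩, rfl⟩
    exact ⟨⟨q, hq, rfl⟩, hq'⟩
  · rintro ⟨⟨q, hq, rfl⟩, hq'⟩
    exact ⟨q, ⟨hq, hq'⟩, rfl⟩

theorem bethFrom_mono (κ : Cardinal.{u}) : Monotone (bethFrom κ) :=
  monotone_nat_of_le_succ fun _ => (cantor _).le

theorem exists_isSystem_le_weakChromaticNumber {κ : Cardinal.{u}} (hκ : ℵ₀ ≤ κ) (m : ℕ)
    (h : bethFrom κ m = succIter κ m) :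
    ∃ (α : Type u) (A : Set (Set α)), IsSystem (succIter κ m) κ 2 A ∧
      ((m / 2 + 2 : ℕ) : Cardinal.{u}) ≤ weakChromaticNumber A := by
  -- All `2 * (m / 2)` fictitious colors are traded away; for odd `m` one exponentiation is left
  -- unused.
  obtain ⟨Pt, Ed, ed, hE, -, hEd, hed, hd, hF⟩ := exists_forces hκ (m / 2) (2 * (m / 2)) 0 rfl
  have hEd' : #Ed ≤ succIter κ m :=
    hEd.trans ((bethFrom_mono κ (Nat.mul_div_le m 2)).trans h.le)
  let L : Type u := (succIter κ m).out
  -- The summand `L` contributes `succIter κ m` pairwise disjoint sets, which fix the cardinality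
  -- and leave the forcing edges intact.
  let F : Ed ⊕ L → Set (Pt ⊕ (L × κ.out)) :=
    Sum.elim (fun e => Sum.inl '' ed e) fun b => Sum.inr '' (Prod.mk b '' Set.univ)
  have hcard : #(Ed ⊕ L) = succIter κ m := by
    rw [mk_sum, lift_id, lift_id, mk_out]
    exact add_eq_right (hκ.trans (succIter_le κ m)) hEd'
  have hsys : IsSystem (succIter κ m) κ 2 (Set.range F) := by
    rw [← hcard]
    refine isSystem_range hκ F ?_ ?_
    · rintro (e | b)
      · exact (mk_image_eq Sum.inl_injective).trans (hed e)
      · refine (mk_image_eq Sum.inr_injective).trans ?_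
        rw [mk_image_eq (Prod.mk_right_injective b), mk_univ, mk_out]
    · rintro (e | b) (e' | b') hne
      · rintro _ ⟨⟨p, hp, rfl⟩, ⟨p', hp', h1⟩⟩ _ ⟨⟨q, hq, rfl⟩, ⟨q', hq', h2⟩⟩
        obtain rfl := Sum.inl_injective h1
        obtain rfl := Sum.inl_injective h2
        rw [hd e e' (fun h => hne (by rw [h])) ⟨hp, hp'⟩ ⟨hq, hq'⟩]
      · rintro _ ⟨⟨p, hp, rfl⟩, ⟨p', hp', h1⟩⟩
        cases h1
      · rintro _ ⟨⟨p, hp, rfl⟩, ⟨p', hp', h1⟩⟩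
        cases h1
      · rintro _ ⟨⟨_, ⟨p, -, rfl⟩, rfl⟩, ⟨_, ⟨p', -, rfl⟩, h1⟩⟩
        have hb : b' = b := congrArg Prod.fst (Sum.inr_injective h1)
        exact absurd (by rw [hb]) hne
  -- An infimum over the empty set would be `0`, so the lower bound needs some coloring to exist.
  have hne : {ρ | ∃ C : Type u, #C = ρ ∧
      ∃ f : Pt ⊕ (L × κ.out) → Option C, IsWeakColoring (Set.range F) f}.Nonempty :=
    ⟨_, ULift.{u} (Fin (m / 2 + 2)), rfl, exists_isWeakColoring hκ m hsys⟩
  refine ⟨_, Set.range F, hsys, le_csInf hne ?_⟩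
  rintro _ ⟨C, rfl, f, hf⟩
  exact le_mk_of_forces (A := Set.range F) hF Sum.inl Sum.inl_injective
    (fun e => ⟨Sum.inl e, rfl⟩) hf

end ConflictFree

theorem mainTheorem6 (κ : Cardinal.{u}) (hκ : Cardinal.aleph0 ≤ κ) (m : ℕ)
    (h : ConflictFree.bethFrom κ m = ConflictFree.succIter κ m) :
    ConflictFree.weakChromaticSup (ConflictFree.succIter κ m) κ 2 =
      ((m / 2 + 2 : ℕ) : Cardinal.{u}) := by
  obtain ⟨α, A, hA, hle⟩ := ConflictFree.exists_isSystem_le_weakChromaticNumber hκ m h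
  have hub : ∀ ρ ∈ {ρ | ∃ (α : Type u) (A : Set (Set α)),
      ConflictFree.IsSystem (ConflictFree.succIter κ m) κ 2 A ∧
        ConflictFree.weakChromaticNumber A = ρ}, ρ ≤ ((m / 2 + 2 : ℕ) : Cardinal.{u}) := by
    rintro _ ⟨α, A, hA, rfl⟩
    exact ConflictFree.weakChromaticNumber_le hκ m hA
  refine le_antisymm (csSup_le ⟨_, α, A, hA, rfl⟩ hub) ?_
  exact hle.trans (le_csSup ⟨_, hub⟩ ⟨α, A, hA, rfl⟩)
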